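/- For a set $X$ and binary relations $s,t\subseteq X\times X$, the demonic composition of $s$ and $t$ is $$s*t=\{(x,y)\in X\times X:\ \exists z\,\big((x,z)\in s\wedge (z,y)\in t\big)\ \wedge\ \forall w\,\big((x,w)\in s\rightarrow \exists v\,(w,v)\in t\big)\}.$$ Let $R(\subseteq,*)$ be the class of all structures, in the first-order signature with one binary relation symbol and one binary function symbol, that are isomorphic to a non-empty set of binary relations on some non-empty set $X$ which is closed under $*$, where the symbols are interpreted as inclusion $\subseteq$ and demonic composition $*$. Let $R(\subseteq,*,1')$ be the class of all structures, in this signature expanded by a constant symbol, that are isomorphic to a set of binary relations on some non-empty set $X$ which is closed under $*$ and contains the diagonal relation $1'=\{(x,x):x\in X\}$, where the symbols are interpreted as $\subseteq$, $*$ and $1'$. Then neither $R(\subseteq,*)$ nor $R(\subseteq,*,1')$ is finitely axiomatisable: for neither of the two classes is there a finite set of first-order sentences (with equality) in its signature whose non-empty models are exactly the members of the class. -/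

import Mathlib

universe u

open FirstOrder

/-- Demonic composition `s * t` of binary relations on `X`:
`(x, y)` belongs to it iff `x s z t y` for some `z`, and every `s`-successor of `x` lies in the
domain of `t`. -/
def demonicComp {X : Type u} (s t : SetRel X X) : SetRel X X :=
  {p | (∃ z, (p.1, z) ∈ s ∧ (z, p.2) ∈ t) ∧ ∀ w, (p.1, w) ∈ s → ∃ v, (w, v) ∈ t}

/-- The only relation symbol: a binary symbol for inclusion. -/
inductive InclSymb : ℕ → Type
  | incl : InclSymb 2

/-- Function symbols of the signature `(⊆, *)`. -/
inductive DemFunc : ℕ → Type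
  | comp : DemFunc 2

/-- Function symbols of the signature `(⊆, *, 1')`; the identity is a constant symbol. -/
inductive DemIdFunc : ℕ → Type
  | comp : DemIdFunc 2
  | ident : DemIdFunc 0

/-- The first-order signature `(⊆, *)`. -/
def demLang : Language := ⟨DemFunc, InclSymb⟩

/-- The first-order signature `(⊆, *, 1')`. -/
def demIdLang : Language := ⟨DemIdFunc, InclSymb⟩

/-- The full algebra of all binary relations on `X` in the signature `(⊆, *)`:
demonic composition and inclusion. -/
instance demStructure (X : Type u) : demLang.Structure (SetRel X X) where
  funMap {_} f := match f with
    | DemFunc.comp => fun a => demonicComp (a 0) (a 1)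
  RelMap {_} r := match r with
    | InclSymb.incl => fun a => a 0 ⊆ a 1

/-- The full algebra of all binary relations on `X` in the signature `(⊆, *, 1')`:
demonic composition, inclusion, and the diagonal relation on `X`. -/
instance demIdStructure (X : Type u) : demIdLang.Structure (SetRel X X) where
  funMap {_} f := match f with
    | DemIdFunc.comp => fun a => demonicComp (a 0) (a 1)
    | DemIdFunc.ident => fun _ => {p : X × X | p.1 = p.2}
  RelMap {_} r := match r with
    | InclSymb.incl => fun a => a 0 ⊆ a 1

/-- The representation class of a signature whose symbols are interpreted in the set of all
binary relations on any set `X`: the structure `A` is isomorphic to a set of binary relations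
on some non-empty `X` that is closed under the operations of the signature (a substructure of
the full algebra). -/
def RepClass (L : Language) [∀ X : Type u, L.Structure (SetRel X X)]
    (A : Type u) [L.Structure A] : Prop :=
  ∃ (X : Type u) (_ : Nonempty X) (C : L.Substructure (SetRel X X)), Nonempty (A ≃[L] C)

/-- A class `K` of (non-empty) `L`-structures is finitely axiomatisable if it is the class of all
models of some finite set of first-order sentences in the signature `L` (with equality). -/
def FinitelyAxiomatisable (L : Language) (K : ∀ (A : Type u) [L.Structure A], Prop) : Prop :=
  ∃ T : L.Theory, T.Finite ∧ ∀ (A : Type u) [L.Structure A] [Nonempty A], A ⊨ T ↔ K A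

/-! The obstruction is a chain. Take products `p i = a i * b` with `a i ≤ p (i + 1)` for `i < n` and
`a 0 ≤ a n`. In relations, a point `x` in the domain of `p 0` lies in the domain of `a 0`, hence of
`p 1`, of `a 1`, and so on up to `p n`. Then all `a n`-successors of `x` lie in the domain of `b`,
so `a 0 ≤ a n` forces `p 0 ≤ p n` at `x`. `ChainElt n` omits this inequality and is not
representable (`not_representable`).

The derivation takes `n` steps, so it disappears in a nonprincipal ultraproduct, which is
representable. Fixing a point of a representation gives a set `D` of relations defined there and a
preorder `R` of inclusion there. Conversely, domain orders that separate the elements yield a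
representation by right translations (`exists_representation`). In `ChainElt n` separation holds
only with domains graded by the number of steps up the order (`separated`); in the ultraproduct the
union over standard degrees is a genuine domain order (`isDomainOrder_ultra`). By Łoś, a finite
axiomatisation would pass from the ultraproduct to almost all factors. -/

/-- A domain predicate `D` and a preorder `R` on an ordered magma, compatible in the way that the
relation "being in the domain at a point" and "being included at a point" are compatible with
demonic composition. -/
structure IsDomainOrder {A : Type u} (mul : A → A → A) (le : A → A → Prop) (D : A → Prop)
    (R : A → A → Prop) : Prop where
  refl : ∀ x, R x x
  trans : ∀ {x y z}, R x y → R y z → R x z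
  dom_left : ∀ {x y}, D (mul x y) → D x
  mono_right : ∀ {x y z}, le y z → D (mul x y) → D (mul x z) ∧ R (mul x y) (mul x z)
  restrict : ∀ {x y z}, D x → R x y → D (mul y z) → D (mul x z) ∧ R (mul x z) (mul y z)

/-- A monoid with a binary relation `le`, whose identity is isolated and irreducible, and in which
failures of `le` are witnessed by domain orders. -/
structure IsDomainSeparated {A : Type u} (mul : A → A → A) (le : A → A → Prop) (one : A) :
    Prop where
  assoc : ∀ x y z, mul (mul x y) z = mul x (mul y z)
  one_mul : ∀ x, mul one x = x
  mul_one : ∀ x, mul x one = x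
  eq_one_or_of_mul : ∀ {x y}, mul x y = one → x = one ∨ y = one
  antisymm : ∀ {x y}, le x y → le y x → x = y
  le_one : ∀ {x}, le x one → x = one
  one_le : ∀ {x}, le one x → x = one
  separated : ∀ {x y}, ¬ le x y → ∃ D R, IsDomainOrder mul le D R ∧ D x ∧ ¬ (D y ∧ R x y)

/-! ### Representation by right translations -/

theorem demonicComp_diag_left {X : Type u} (t : SetRel X X) :
    demonicComp {p : X × X | p.1 = p.2} t = t := by
  ext ⟨x, y⟩
  constructor
  · rintro ⟨⟨z, e : x = z, h⟩, -⟩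
    exact e ▸ h
  · intro h
    exact ⟨⟨x, rfl, h⟩, fun w (e : x = w) => ⟨y, e ▸ h⟩⟩

theorem demonicComp_diag_right {X : Type u} (s : SetRel X X) :
    demonicComp s {p : X × X | p.1 = p.2} = s := by
  ext ⟨x, y⟩
  constructor
  · rintro ⟨⟨z, h, e : z = y⟩, -⟩
    exact e ▸ h
  · intro h
    exact ⟨⟨y, h, rfl⟩, fun w _ => ⟨w, rfl⟩⟩

/-- The relation on `ι × A` which the right translation by `b` induces through a family of domain
orders; the identity becomes the diagonal. -/
def translationRel {A ι : Type u} (mul : A → A → A) (one : A) (D : ι → A → Prop)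
    (R : ι → A → A → Prop) (b : A) : SetRel (ι × A) (ι × A) :=
  {p | (b = one ∧ p.1 = p.2) ∨ (b ≠ one ∧ p.1.1 = p.2.1 ∧ D p.1.1 (mul p.1.2 b) ∧
    D p.1.1 p.2.2 ∧ R p.1.1 p.2.2 (mul p.1.2 b))}

theorem translationRel_one {A ι : Type u} (mul : A → A → A) (one : A) (D : ι → A → Prop)
    (R : ι → A → A → Prop) :
    translationRel mul one D R one = {p : (ι × A) × (ι × A) | p.1 = p.2} := by
  ext p
  simp [translationRel]

theorem mk_mem_translationRel {A ι : Type u} {mul : A → A → A} {one : A} {D : ι → A → Prop}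
    {R : ι → A → A → Prop} {b : A} (hb : b ≠ one) {i j : ι} {x y : A} :
    ((i, x), (j, y)) ∈ translationRel mul one D R b ↔
      i = j ∧ D i (mul x b) ∧ D i y ∧ R i y (mul x b) := by
  simp [translationRel, hb]

namespace IsDomainSeparated

variable {A : Type u} {mul : A → A → A} {le : A → A → Prop} {one : A}

theorem translationRel_mul (h : IsDomainSeparated mul le one) {ι : Type u} {D : ι → A → Prop}
    {R : ι → A → A → Prop} (hD : ∀ i, IsDomainOrder mul le (D i) (R i)) (a b : A) :
    translationRel mul one D R (mul a b) =
      demonicComp (translationRel mul one D R a) (translationRel mul one D R b) := by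
  by_cases ha : a = one
  · subst ha
    rw [h.one_mul, translationRel_one, demonicComp_diag_left]
  by_cases hb : b = one
  · subst hb
    rw [h.mul_one, translationRel_one, demonicComp_diag_right]
  have hab : mul a b ≠ one := fun e => (h.eq_one_or_of_mul e).elim ha hb
  ext ⟨⟨i, x⟩, ⟨j, y⟩⟩
  rw [mk_mem_translationRel hab, ← h.assoc]
  constructor
  · rintro ⟨rfl, h1, h2, h3⟩
    have h4 := (hD i).dom_left h1
    refine ⟨⟨(i, mul x a), (mk_mem_translationRel ha).2 ⟨rfl, h4, h4, (hD i).refl _⟩,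
      (mk_mem_translationRel hb).2 ⟨rfl, h1, h2, h3⟩⟩, ?_⟩
    rintro ⟨k, w⟩ hw
    obtain ⟨rfl, -, h6, h7⟩ := (mk_mem_translationRel ha).1 hw
    have h8 := ((hD i).restrict h6 h7 h1).1
    exact ⟨(i, mul w b), (mk_mem_translationRel hb).2 ⟨rfl, h8, h8, (hD i).refl _⟩⟩
  · rintro ⟨⟨⟨k, z⟩, hz, hzy⟩, hall⟩
    obtain ⟨rfl, h1, h2, h3⟩ := (mk_mem_translationRel ha).1 hz
    obtain ⟨rfl, h4, h5, h6⟩ := (mk_mem_translationRel hb).1 hzy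
    -- The totality clause is tested at the largest `a`-successor, `x * a` itself.
    obtain ⟨⟨k, v⟩, hv⟩ := hall (i, mul x a)
      ((mk_mem_translationRel ha).2 ⟨rfl, h1, h1, (hD i).refl _⟩)
    obtain ⟨-, h7, -, -⟩ := (mk_mem_translationRel hb).1 hv
    exact ⟨rfl, h7, h5, (hD i).trans h6 ((hD i).restrict h2 h3 h7).2⟩

theorem translationRel_subset (h : IsDomainSeparated mul le one) {ι : Type u}
    {D : ι → A → Prop} {R : ι → A → A → Prop} (hD : ∀ i, IsDomainOrder mul le (D i) (R i))
    {a b : A} (hab : le a b) : translationRel mul one D R a ⊆ translationRel mul one D R b := by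
  by_cases ha : a = one
  · subst ha
    rw [h.one_le hab]
  have hb : b ≠ one := fun e => ha (h.le_one (e ▸ hab))
  rintro ⟨⟨i, x⟩, ⟨j, y⟩⟩ hxy
  obtain ⟨rfl, h1, h2, h3⟩ := (mk_mem_translationRel ha).1 hxy
  obtain ⟨h4, h5⟩ := (hD i).mono_right hab h1
  exact (mk_mem_translationRel hb).2 ⟨rfl, h4, h2, (hD i).trans h3 h5⟩

theorem not_translationRel_subset (h : IsDomainSeparated mul le one) {ι : Type u}
    {D : ι → A → Prop} {R : ι → A → A → Prop} (hD : ∀ i, IsDomainOrder mul le (D i) (R i))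
    {a b : A} {i : ι} (ha : D i a) (hab : ¬ (D i b ∧ R i a b)) {j : ι} (hj : ∀ x, ¬ D j x) :
    ¬ translationRel mul one D R a ⊆ translationRel mul one D R b := by
  intro hsub
  have hne : a ≠ b := by
    rintro rfl
    exact hab ⟨ha, (hD i).refl _⟩
  by_cases ha1 : a = one
  · subst ha1
    -- Over the empty domain `D j` only the identity relates anything, so its diagonal pairs
    -- separate it from `b`.
    have := hsub (a := ((j, a), (j, a))) (by rw [translationRel_one]; exact rfl)
    obtain ⟨-, -, h3, -⟩ := (mk_mem_translationRel (Ne.symm hne)).1 this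
    exact hj _ h3
  have hmem : ((i, one), (i, a)) ∈ translationRel mul one D R a :=
    (mk_mem_translationRel ha1).2 ⟨rfl, by rwa [h.one_mul], ha, by
      rw [h.one_mul]; exact (hD i).refl _⟩
  have := hsub hmem
  by_cases hb : b = one
  · subst hb
    rw [translationRel_one] at this
    exact ha1 (congrArg Prod.snd this).symm
  · obtain ⟨-, h2, -, h4⟩ := (mk_mem_translationRel hb).1 this
    rw [h.one_mul] at h2 h4
    exact hab ⟨h2, h4⟩

/-- A domain-separated monoid is isomorphic to an algebra of binary relations. -/
theorem exists_representation (h : IsDomainSeparated mul le one) :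
    ∃ (X : Type u) (_ : Nonempty X) (f : A → SetRel X X), Function.Injective f ∧
      (∀ a b, f (mul a b) = demonicComp (f a) (f b)) ∧ (∀ a b, f a ⊆ f b ↔ le a b) ∧
      f one = {p : X × X | p.1 = p.2} := by
  let ι : Type u := {q : (A → Prop) × (A → A → Prop) // IsDomainOrder mul le q.1 q.2}
  let D : ι → A → Prop := fun i => i.1.1
  let R : ι → A → A → Prop := fun i => i.1.2
  have hD : ∀ i, IsDomainOrder mul le (D i) (R i) := fun i => i.2
  -- The domain order of a point where only the identity is defined.
  let j : ι := ⟨(fun _ => False, fun _ _ => True), by constructor <;> simp⟩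
  have hiff : ∀ a b, translationRel mul one D R a ⊆ translationRel mul one D R b ↔ le a b := by
    intro a b
    refine ⟨fun hsub => ?_, h.translationRel_subset hD⟩
    by_contra hab
    obtain ⟨D', R', h1, h2, h3⟩ := h.separated hab
    exact h.not_translationRel_subset hD (i := ⟨(D', R'), h1⟩) (j := j) h2 h3 (fun _ => id) hsub
  refine ⟨ι × A, ⟨(j, one)⟩, translationRel mul one D R, fun a b hab => ?_,
    h.translationRel_mul hD, hiff, translationRel_one _ _ _ _⟩
  exact h.antisymm ((hiff a b).1 hab.subset) ((hiff b a).1 hab.symm.subset)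

end IsDomainSeparated

open Language Structure in
theorem repClass_demLang_of_isDomainSeparated {A : Type u} [demLang.Structure A]
    {one : A} (h : IsDomainSeparated (fun x y : A => funMap (L := demLang) DemFunc.comp ![x, y])
      (fun x y => RelMap (L := demLang) InclSymb.incl ![x, y]) one) : RepClass demLang A := by
  obtain ⟨X, hX, f, hinj, hmul, hle, -⟩ := h.exists_representation
  let e : A ↪[demLang] SetRel X X :=
    { toFun := f
      inj' := hinj
      map_fun' := by
        intro n g x
        cases g
        rw [show x = ![x 0, x 1] by ext i; fin_cases i <;> rfl]
        exact hmul _ _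
      map_rel' := by
        intro n r x
        cases r
        rw [show x = ![x 0, x 1] by ext i; fin_cases i <;> rfl]
        exact hle _ _ }
  exact ⟨X, hX, e.toHom.range, ⟨e.equivRange⟩⟩

open Language Structure in
theorem repClass_demIdLang_of_isDomainSeparated {A : Type u} [demIdLang.Structure A]
    (h : IsDomainSeparated (fun x y : A => funMap (L := demIdLang) DemIdFunc.comp ![x, y])
      (fun x y => RelMap (L := demIdLang) InclSymb.incl ![x, y])
      (funMap (L := demIdLang) DemIdFunc.ident ![])) : RepClass demIdLang A := by
  obtain ⟨X, hX, f, hinj, hmul, hle, hone⟩ := h.exists_representation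
  let e : A ↪[demIdLang] SetRel X X :=
    { toFun := f
      inj' := hinj
      map_fun' := by
        intro n g x
        cases g
        · rw [show x = ![x 0, x 1] by ext i; fin_cases i <;> rfl]
          exact hmul _ _
        · rw [show x = ![] from Subsingleton.elim _ _]
          exact hone
      map_rel' := by
        intro n r x
        cases r
        rw [show x = ![x 0, x 1] by ext i; fin_cases i <;> rfl]
        exact hle _ _ }
  exact ⟨X, hX, e.toHom.range, ⟨e.equivRange⟩⟩

/-! ### The chain algebras and their graded domain orders -/

/-- A family of domain orders graded by the natural numbers, in which comparing one step up the
order raises the degree by one; the laws are required only in degrees below `n`. -/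
structure IsGradedDomainOrder {A : Type u} (mul : A → A → A) (le : A → A → Prop) (n : ℕ)
    (D : ℕ → A → Prop) (R : A → A → Prop) : Prop where
  refl : ∀ x, R x x
  trans : ∀ {x y z}, R x y → R y z → R x z
  mono : ∀ {k l x}, k ≤ l → D k x → D l x
  dom_left : ∀ {k x y}, D k (mul x y) → D k x
  mono_right : ∀ {k x y z}, le y z → D k (mul x y) → D (k + 1) (mul x z) ∧ R (mul x y) (mul x z)
  restrict : ∀ {k x y z}, k < n → D k x → R x y → D k (mul y z) →
    D k (mul x z) ∧ R (mul x z) (mul y z)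

/-- The elements of the algebra with generators `b`, `a i` and products `p i = a i * b`. -/
inductive ChainElt (n : ℕ) : Type u
  | one
  | zero
  | b
  | a (i : ℕ)
  | p (i : ℕ)

namespace ChainElt

variable {n : ℕ}

/-- All products of non-identity elements vanish, apart from `a i * b = p i`. -/
def mul : ChainElt.{u} n → ChainElt.{u} n → ChainElt.{u} n
  | one, y => y
  | zero, one => zero
  | b, one => b
  | a i, one => a i
  | p i, one => p i
  | a i, b => p i
  | _, _ => zero

/-- The order, generated by `a i ≤ p (i + 1)` for `i < n` and `a 0 ≤ a n`. -/
inductive Le : ChainElt.{u} n → ChainElt.{u} n → Prop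
  | refl (x) : Le x x
  | step {i : ℕ} (h : i < n) : Le (a i) (p (i + 1))
  | long : Le (a 0) (a n)

instance : Nonempty (ChainElt.{u} n) := ⟨one⟩

instance : demLang.Structure (ChainElt.{u} n) where
  funMap {_} f := match f with
    | DemFunc.comp => fun v => mul (v 0) (v 1)
  RelMap {_} r := match r with
    | InclSymb.incl => fun v => Le (v 0) (v 1)

instance : demIdLang.Structure (ChainElt.{u} n) where
  funMap {_} f := match f with
    | DemIdFunc.comp => fun v => mul (v 0) (v 1)
    | DemIdFunc.ident => fun _ => one
  RelMap {_} r := match r with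
    | InclSymb.incl => fun v => Le (v 0) (v 1)

theorem mul_one' (x : ChainElt.{u} n) : mul x one = x := by cases x <;> rfl

theorem mul_assoc' (x y z : ChainElt.{u} n) : mul (mul x y) z = mul x (mul y z) := by
  cases x <;> cases y <;> cases z <;> rfl

theorem eq_one_or_of_mul {x y : ChainElt.{u} n} (h : mul x y = one) : x = one ∨ y = one := by
  cases x <;> cases y <;> simp_all [mul]

theorem Le.antisymm {x y : ChainElt.{u} n} (h : Le x y) (h' : Le y x) : x = y := by
  cases h with
  | refl => rfl
  | step h => cases h'
  | long => cases h' <;> rfl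

theorem le_one {x : ChainElt.{u} n} (h : Le x one) : x = one := by cases h; rfl

theorem one_le {x : ChainElt.{u} n} (h : Le one x) : x = one := by cases h; rfl

/-- The order with `p 0 ≤ p n` added. -/
inductive LeP : ChainElt.{u} n → ChainElt.{u} n → Prop
  | of_le {x y} : Le x y → LeP x y
  | long : LeP (p 0) (p n)

/-- The order with `p 0 ≤ p n` added, and `zero` put on top of all `a i` and `p i`. -/
inductive LeZ : ChainElt.{u} n → ChainElt.{u} n → Prop
  | of_le {x y} : LeP x y → LeZ x y
  | a (i : ℕ) : LeZ (a i) zero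
  | p (i : ℕ) : LeZ (p i) zero

/-- Being a generator `a i`, a product `p i` or the identity. -/
def IsChain : ChainElt.{u} n → Prop
  | one | a _ | p _ => True
  | _ => False

/-- Being the identity, `a n`, or one of `a i`, `p i` with `i ≤ k`. -/
def IsLow (k : ℕ) : ChainElt.{u} n → Prop
  | one => True
  | a i => i ≤ k ∨ i = n
  | p i => i ≤ k
  | _ => False

theorem Le.trans {x y z : ChainElt.{u} n} (h : Le x y) (h' : Le y z) : Le x z := by
  cases h with
  | refl => exact h'
  | step h => cases h'; exact .step h
  | long =>
    cases h' with
    | refl => exact .long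
    | step h => exact absurd h (lt_irrefl _)
    | long => exact .long

theorem mul_le_mul_left {x y z : ChainElt.{u} n} (h : Le y z) : Le (mul x y) (mul x z) := by
  cases h with
  | refl => exact .refl _
  | step h => cases x <;> first | exact .refl _ | exact .step h
  | long => cases x <;> first | exact .refl _ | exact .long

theorem LeP.trans {x y z : ChainElt.{u} n} (h : LeP x y) (h' : LeP y z) :
    LeP x z := by
  cases h with
  | of_le h =>
    cases h' with
    | of_le h' => exact .of_le (h.trans h')
    | long => cases h; exact .long
  | long =>
    cases h' with
    | of_le h' => cases h'; exact .long
    | long => exact .long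

theorem LeZ.trans {x y z : ChainElt.{u} n} (h : LeZ x y) (h' : LeZ y z) :
    LeZ x z := by
  cases h with
  | of_le h =>
    cases h' with
    | of_le h' => exact .of_le (h.trans h')
    | a i => cases h with | of_le h => cases h <;> exact .a _
    | p i =>
      cases h with
      | of_le h => cases h <;> first | exact .a _ | exact .p _
      | long => exact .p _
  | a i => cases h' with | of_le h' => cases h' with | of_le h' => cases h'; exact .a _
  | p i => cases h' with | of_le h' => cases h' with | of_le h' => cases h'; exact .p _

/-- Multiplying `a i ≤ p (i + 1)` by `b` gives `p i` against `zero`; this is why `zero` must be on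
top. -/
theorem LeZ.mul_right {x y : ChainElt.{u} n} (h : LeZ x y) (z : ChainElt.{u} n) :
    LeZ (mul x z) (mul y z) := by
  cases h with
  | of_le h =>
    cases h with
    | of_le h =>
      cases h with
      | refl => exact .of_le (.of_le (.refl _))
      | step h =>
        cases z <;> first
          | exact .of_le (.of_le (.refl _))
          | exact .of_le (.of_le (.step h))
          | exact .p _
      | long =>
        cases z <;> first
          | exact .of_le (.of_le (.refl _))
          | exact .of_le (.of_le .long)
          | exact .of_le .long
    | long =>
      cases z <;> first
        | exact .of_le (.of_le (.refl _))
        | exact .of_le .long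
  | a i =>
    cases z <;> first
      | exact .of_le (.of_le (.refl _))
      | exact .a _
      | exact .p _
  | p i =>
    cases z <;> first
      | exact .of_le (.of_le (.refl _))
      | exact .p _

theorem isGradedDomainOrder_leZ :
    IsGradedDomainOrder mul (Le.{u} (n := n)) n (fun _ _ => True) LeZ where
  refl x := .of_le (.of_le (.refl x))
  trans := LeZ.trans
  mono _ h := h
  dom_left h := h
  mono_right h _ := ⟨trivial, .of_le (.of_le (mul_le_mul_left h))⟩
  restrict _ _ h _ := ⟨trivial, h.mul_right _⟩

/-- With `zero` outside the domain, `a i ≤ p (i + 1)` imposes nothing after multiplication by `b`;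
only `a 0 ≤ a n` does, giving `p 0 ≤ p n`. -/
theorem isGradedDomainOrder_leP :
    IsGradedDomainOrder mul (Le.{u} (n := n)) n (fun _ => IsChain) LeP where
  refl x := .of_le (.refl x)
  trans := LeP.trans
  mono _ h := h
  dom_left := by
    intro k x y h
    cases x <;> cases y <;> first | exact trivial | exact h
  mono_right := by
    intro k x y z h h'
    refine ⟨?_, .of_le (mul_le_mul_left h)⟩
    have := mul_le_mul_left (x := x) h
    generalize mul x y = u at *
    generalize mul x z = v at *
    cases this <;> exact h'
  restrict := by
    intro k x y z _ hx h hyz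
    cases h with
    | of_le h =>
      cases h with
      | refl => exact ⟨hyz, .of_le (.refl _)⟩
      | step h =>
        cases z <;> first
          | exact ⟨trivial, .of_le (.step h)⟩
          | exact hyz.elim
      | long =>
        cases z <;> first
          | exact ⟨trivial, .of_le .long⟩
          | exact ⟨trivial, .long⟩
          | exact hyz.elim
    | long =>
      cases z <;> first
        | exact ⟨trivial, .long⟩
        | exact hyz.elim

/-- Restricting `a 0 ≤ a n` by `b` would demand `p 0 ≤ p n`, but only once `p n` enters the domain,
in degree `n`. -/
theorem isGradedDomainOrder_le :
    IsGradedDomainOrder mul (Le.{u} (n := n)) n IsLow Le where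
  refl := .refl
  trans := Le.trans
  mono := by
    intro k l x hkl h
    cases x <;> simp only [IsLow] at h ⊢ <;> omega
  dom_left := by
    intro k x y h
    cases x <;> cases y <;> simp_all [IsLow, mul]
  mono_right := by
    intro k x y z h h'
    have := mul_le_mul_left (x := x) h
    refine ⟨?_, this⟩
    generalize mul x y = u at *
    generalize mul x z = v at *
    cases this with
    | refl => cases u <;> simp only [IsLow] at h' ⊢ <;> omega
    | step h => simp only [IsLow] at h' ⊢; omega
    | long => simp [IsLow]
  restrict := by
    intro k x y z hk hx h hyz
    cases h with
    | refl => exact ⟨hyz, .refl _⟩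
    | step h =>
      cases z <;> first
        | exact ⟨hx, .step h⟩
        | exact hyz.elim
    | long =>
      cases z <;> first
        | exact ⟨hx, .long⟩
        | exact absurd hk (not_lt.2 hyz)
        | exact hyz.elim

/-- The three orders handle successive cases: `LeZ` fails; only the inequalities below `zero` are
spurious; or the pair is `p 0`, `p n`, where the second is undefined below degree `n`. -/
theorem separated {x y : ChainElt.{u} n} (h : ¬ Le x y) :
    ∃ D R, IsGradedDomainOrder mul (Le.{u} (n := n)) n D R ∧ D 0 x ∧
      ∀ k < n, ¬ (D k y ∧ R x y) := by
  by_cases hz : LeZ x y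
  · by_cases hp : LeP x y
    · cases hp with
      | of_le h' => exact absurd h' h
      | long =>
        exact ⟨IsLow, Le, isGradedDomainOrder_le, le_rfl, fun k hk h' => absurd hk (not_lt.2 h'.1)⟩
    · refine ⟨fun _ => IsChain, LeP, isGradedDomainOrder_leP, ?_, fun k _ h' => hp h'.2⟩
      cases hz with
      | of_le h' => exact absurd h' hp
      | a i => exact trivial
      | p i => exact trivial
  · exact ⟨fun _ _ => True, LeZ, isGradedDomainOrder_leZ, trivial, fun k _ h' => hz h'.2⟩

/-! ### Non-representability of the chain algebras -/

theorem not_representable (hn : n ≠ 0) {X : Type u} (f : ChainElt.{u} n → SetRel X X)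
    (hmul : ∀ x y, f (mul x y) = demonicComp (f x) (f y)) (hle : ∀ x y, f x ⊆ f y ↔ Le x y) :
    False := by
  have hp : ∀ i, f (p i) = demonicComp (f (a i)) (f b) := fun i => hmul (a i) b
  have hnot : ¬ Le (p 0 : ChainElt.{u} n) (p n) := by
    intro h
    generalize hm : n = m at h hn
    cases h
    exact hn rfl
  apply hnot
  rw [← hle]
  rintro ⟨x, y⟩ hxy
  have hdom : ∀ i ≤ n, ∃ z, (x, z) ∈ f (p i) := by
    intro i
    induction i with
    | zero => exact fun _ => ⟨y, hxy⟩
    | succ i ih =>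
      intro hi
      obtain ⟨z, hz⟩ := ih (by omega)
      rw [hp] at hz
      obtain ⟨⟨w, hw, -⟩, -⟩ := hz
      exact ⟨w, (hle _ _).2 (.step hi) hw⟩
  obtain ⟨v, hv⟩ := hdom n le_rfl
  rw [hp] at hv hxy ⊢
  obtain ⟨⟨z, hz, hzy⟩, -⟩ := hxy
  -- The totality clause depends on `x` alone, so it can be taken from the pair `(x, v)`.
  exact ⟨⟨z, (hle _ _).2 .long hz, hzy⟩, hv.2⟩

theorem not_repClass_demLang (hn : n ≠ 0) : ¬ RepClass demLang (ChainElt.{u} n) := by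
  rintro ⟨X, -, C, ⟨e⟩⟩
  let g : ChainElt.{u} n ↪[demLang] SetRel X X := C.subtype.comp e.toEmbedding
  exact not_representable hn g (fun x y => g.map_fun DemFunc.comp ![x, y])
    (fun x y => g.map_rel InclSymb.incl ![x, y])

theorem not_repClass_demIdLang (hn : n ≠ 0) : ¬ RepClass demIdLang (ChainElt.{u} n) := by
  rintro ⟨X, -, C, ⟨e⟩⟩
  let g : ChainElt.{u} n ↪[demIdLang] SetRel X X := C.subtype.comp e.toEmbedding
  exact not_representable hn g (fun x y => g.map_fun DemIdFunc.comp ![x, y])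
    (fun x y => g.map_rel InclSymb.incl ![x, y])

/-! ### Representability of the ultraproduct -/

open Filter

/-- The ultraproduct of the algebras `ChainElt n` over a nonprincipal ultrafilter. -/
abbrev Ultra : Type u := (hyperfilter ℕ : Filter ℕ).Product fun n => ChainElt.{u} n

/-- The class of a sequence in the ultraproduct. -/
noncomputable def toUltra (f : ∀ n, ChainElt.{u} n) : Ultra.{u} :=
  Quotient.mk (productSetoid _ _) f

theorem toUltra_eq_iff {f g : ∀ n, ChainElt.{u} n} :
    toUltra f = toUltra g ↔ ∀ᶠ n in hyperfilter ℕ, f n = g n :=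
  Quotient.eq (r := productSetoid _ _)

theorem exists_toUltra (x : Ultra.{u}) : ∃ f, toUltra f = x :=
  Quotient.exists_rep x

theorem eventually_lt (k : ℕ) : ∀ᶠ n in (hyperfilter ℕ : Filter ℕ), k < n :=
  Nat.hyperfilter_le_atTop (eventually_gt_atTop k)

/-- A sequence of graded domain orders yields a domain order on the ultraproduct. -/
theorem isDomainOrder_ultra {mul' : Ultra.{u} → Ultra.{u} → Ultra.{u}}
    {le' : Ultra.{u} → Ultra.{u} → Prop}
    (hmul : ∀ f g, mul' (toUltra f) (toUltra g) = toUltra fun n => mul (f n) (g n))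
    (hle : ∀ f g, le' (toUltra f) (toUltra g) ↔ ∀ᶠ n in hyperfilter ℕ, Le (f n) (g n))
    {D : ∀ n, ℕ → ChainElt.{u} n → Prop} {R : ∀ n, ChainElt.{u} n → ChainElt.{u} n → Prop}
    (h : ∀ᶠ n in hyperfilter ℕ, IsGradedDomainOrder mul Le n (D n) (R n)) :
    IsDomainOrder mul' le'
      (fun x => ∃ f k, toUltra f = x ∧ ∀ᶠ n in hyperfilter ℕ, D n k (f n))
      (fun x y => ∀ f g, toUltra f = x → toUltra g = y →
        ∀ᶠ n in hyperfilter ℕ, R n (f n) (g n)) where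
  refl x f g hf hg := by
    filter_upwards [h, toUltra_eq_iff.1 (hf.trans hg.symm)] with n h1 h2
    rw [h2]
    exact h1.refl _
  trans := by
    intro x y z hxy hyz f g hf hg
    obtain ⟨e, rfl⟩ := exists_toUltra y
    filter_upwards [h, hxy f e hf rfl, hyz e g rfl hg] with n h1 h2 h3
    exact h1.trans h2 h3
  dom_left := by
    rintro x y ⟨e, k, he, hk⟩
    obtain ⟨f, rfl⟩ := exists_toUltra x
    obtain ⟨g, rfl⟩ := exists_toUltra y
    rw [hmul, toUltra_eq_iff] at he
    refine ⟨f, k, rfl, ?_⟩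
    filter_upwards [h, he, hk] with n h1 h2 h3
    rw [h2] at h3
    exact h1.dom_left h3
  mono_right := by
    rintro x y z hyz ⟨e, k, he, hk⟩
    obtain ⟨f, rfl⟩ := exists_toUltra x
    obtain ⟨g, rfl⟩ := exists_toUltra y
    obtain ⟨g', rfl⟩ := exists_toUltra z
    rw [hle] at hyz
    rw [hmul, toUltra_eq_iff] at he
    have key : ∀ᶠ n in hyperfilter ℕ, D n (k + 1) (mul (f n) (g' n)) ∧
        R n (mul (f n) (g n)) (mul (f n) (g' n)) := by
      filter_upwards [h, he, hk, hyz] with n h1 h2 h3 h4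
      rw [h2] at h3
      exact h1.mono_right h4 h3
    refine ⟨⟨_, k + 1, (hmul f g').symm, key.mono fun n hn => hn.1⟩, ?_⟩
    intro u v hu hv
    rw [hmul, toUltra_eq_iff] at hu hv
    filter_upwards [key, hu, hv] with n h1 h2 h3
    rw [h2, h3]
    exact h1.2
  restrict := by
    rintro x y z ⟨f, k, rfl, hk⟩ hxy ⟨e, l, he, hl⟩
    obtain ⟨g, rfl⟩ := exists_toUltra y
    obtain ⟨w, rfl⟩ := exists_toUltra z
    rw [hmul, toUltra_eq_iff] at he
    -- Both degrees are standard, so their maximum is below `n` for almost all `n` and the graded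
    -- law applies.
    have key : ∀ᶠ n in hyperfilter ℕ, D n (max k l) (mul (f n) (w n)) ∧
        R n (mul (f n) (w n)) (mul (g n) (w n)) := by
      filter_upwards [h, he, hk, hl, hxy f g rfl rfl, eventually_lt (max k l)]
        with n h1 h2 h3 h4 h5 h6
      rw [h2] at h4
      exact h1.restrict h6 (h1.mono (le_max_left _ _) h3) h5 (h1.mono (le_max_right _ _) h4)
    refine ⟨⟨_, _, (hmul f w).symm, key.mono fun n hn => hn.1⟩, ?_⟩
    intro u v hu hv
    rw [hmul, toUltra_eq_iff] at hu hv
    filter_upwards [key, hu, hv] with n h1 h2 h3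
    rw [h2, h3]
    exact h1.2

theorem isDomainSeparated_ultra {mul' : Ultra.{u} → Ultra.{u} → Ultra.{u}}
    {le' : Ultra.{u} → Ultra.{u} → Prop}
    (hmul : ∀ f g, mul' (toUltra f) (toUltra g) = toUltra fun n => mul (f n) (g n))
    (hle : ∀ f g, le' (toUltra f) (toUltra g) ↔ ∀ᶠ n in hyperfilter ℕ, Le (f n) (g n)) :
    IsDomainSeparated mul' le' (toUltra fun _ => one) where
  assoc x y z := by
    obtain ⟨f, rfl⟩ := exists_toUltra x
    obtain ⟨g, rfl⟩ := exists_toUltra y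
    obtain ⟨w, rfl⟩ := exists_toUltra z
    simp only [hmul, mul_assoc']
  one_mul x := by
    obtain ⟨f, rfl⟩ := exists_toUltra x
    rw [hmul]
    rfl
  mul_one x := by
    obtain ⟨f, rfl⟩ := exists_toUltra x
    simp only [hmul, mul_one']
  eq_one_or_of_mul := by
    intro x y h
    obtain ⟨f, rfl⟩ := exists_toUltra x
    obtain ⟨g, rfl⟩ := exists_toUltra y
    rw [hmul, toUltra_eq_iff] at h
    rw [toUltra_eq_iff, toUltra_eq_iff, ← Ultrafilter.eventually_or]
    exact h.mono fun n => eq_one_or_of_mul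
  antisymm := by
    intro x y h h'
    obtain ⟨f, rfl⟩ := exists_toUltra x
    obtain ⟨g, rfl⟩ := exists_toUltra y
    rw [hle] at h h'
    rw [toUltra_eq_iff]
    filter_upwards [h, h'] with n h1 h2
    exact h1.antisymm h2
  le_one := by
    intro x h
    obtain ⟨f, rfl⟩ := exists_toUltra x
    rw [hle] at h
    exact toUltra_eq_iff.2 (h.mono fun n => ChainElt.le_one)
  one_le := by
    intro x h
    obtain ⟨f, rfl⟩ := exists_toUltra x
    rw [hle] at h
    exact toUltra_eq_iff.2 (h.mono fun n => ChainElt.one_le)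
  separated := by
    intro x y h
    obtain ⟨f, rfl⟩ := exists_toUltra x
    obtain ⟨g, rfl⟩ := exists_toUltra y
    rw [hle, ← Ultrafilter.eventually_not] at h
    have hsep : ∀ n, ∃ D R, ¬ Le (f n) (g n) →
        IsGradedDomainOrder mul (Le.{u} (n := n)) n D R ∧ D 0 (f n) ∧
          ∀ k < n, ¬ (D k (g n) ∧ R (f n) (g n)) := by
      intro n
      by_cases hn : ¬ Le (f n) (g n)
      · obtain ⟨D, R, hDR⟩ := ChainElt.separated hn
        exact ⟨D, R, fun _ => hDR⟩
      -- An arbitrary value on a negligible set of indices.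
      · exact ⟨fun _ _ => True, fun _ _ => True, fun h => absurd h hn⟩
    choose D R hDR using hsep
    have key : ∀ᶠ n in hyperfilter ℕ, IsGradedDomainOrder mul (Le.{u} (n := n)) n (D n) (R n) ∧
        D n 0 (f n) ∧ ∀ k < n, ¬ (D n k (g n) ∧ R n (f n) (g n)) := by
      exact h.mono hDR
    refine ⟨_, _, isDomainOrder_ultra hmul hle (key.mono fun n hn => hn.1),
      ⟨f, 0, rfl, key.mono fun n hn => hn.2.1⟩, ?_⟩
    rintro ⟨⟨e, k, he, hk⟩, hR⟩
    rw [toUltra_eq_iff] at he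
    obtain ⟨n, h1, h2, h3, h4, h5⟩ :=
      (key.and (he.and (hk.and ((hR f g rfl rfl).and (eventually_lt k))))).exists
    rw [h2] at h3
    exact h1.2.2 k h5 ⟨h3, h4⟩

theorem repClass_demLang_ultra : RepClass demLang Ultra.{u} := by
  refine repClass_demLang_of_isDomainSeparated (isDomainSeparated_ultra (fun f g => ?_)
    (fun f g => ?_))
  · rw [show (![toUltra f, toUltra g] : Fin 2 → Ultra.{u}) = fun i => toUltra (![f, g] i) by
      ext i; fin_cases i <;> rfl]
    exact Language.Ultraproduct.funMap_cast (L := demLang) DemFunc.comp ![f, g]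
  · rw [show (![toUltra f, toUltra g] : Fin 2 → Ultra.{u}) = fun i => toUltra (![f, g] i) by
      ext i; fin_cases i <;> rfl]
    exact Language.relMap_quotient_mk' (L := demLang) _ InclSymb.incl ![f, g]

theorem repClass_demIdLang_ultra : RepClass demIdLang Ultra.{u} := by
  have hone : Language.Structure.funMap (L := demIdLang) DemIdFunc.ident
      (![] : Fin 0 → Ultra.{u}) = toUltra fun _ => one := by
    rw [show (![] : Fin 0 → Ultra.{u}) = fun i => toUltra (Fin.elim0 i) from
      Subsingleton.elim _ _]
    exact Language.Ultraproduct.funMap_cast (L := demIdLang) DemIdFunc.ident fun i => Fin.elim0 i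
  apply repClass_demIdLang_of_isDomainSeparated
  rw [hone]
  refine isDomainSeparated_ultra (fun f g => ?_) (fun f g => ?_)
  · rw [show (![toUltra f, toUltra g] : Fin 2 → Ultra.{u}) = fun i => toUltra (![f, g] i) by
      ext i; fin_cases i <;> rfl]
    exact Language.Ultraproduct.funMap_cast (L := demIdLang) DemIdFunc.comp ![f, g]
  · rw [show (![toUltra f, toUltra g] : Fin 2 → Ultra.{u}) = fun i => toUltra (![f, g] i) by
      ext i; fin_cases i <;> rfl]
    exact Language.relMap_quotient_mk' (L := demIdLang) _ InclSymb.incl ![f, g]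

end ChainElt

/-! ### Transfer to the factors by Łoś -/

open Filter in
/-- If a class of structures is finitely axiomatisable and contains an ultraproduct, it contains
almost all of the factors. -/
theorem FinitelyAxiomatisable.eventually_of_ultraproduct {L : Language}
    {K : ∀ (A : Type u) [L.Structure A], Prop} (h : FinitelyAxiomatisable L K)
    {M : ℕ → Type u} [∀ n, L.Structure (M n)] [∀ n, Nonempty (M n)] {U : Ultrafilter ℕ}
    (hU : K ((U : Filter ℕ).Product M)) : ∀ᶠ n in (U : Filter ℕ), K (M n) := by
  obtain ⟨T, hT, hK⟩ := h
  have hmodel := (hK ((U : Filter ℕ).Product M)).2 hU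
  have hall : ∀ᶠ n in (U : Filter ℕ), ∀ φ ∈ T, M n ⊨ φ :=
    (eventually_all_finite hT).2 fun φ hφ =>
      (Language.Ultraproduct.sentence_realize φ).1 (hmodel.realize_of_mem φ hφ)
  exact hall.mono fun n hn => (hK (M n)).1 ⟨hn⟩

open ChainElt in
theorem mainTheorem1 :
    ¬ FinitelyAxiomatisable demLang (fun (A : Type u) _ => RepClass demLang A) ∧
    ¬ FinitelyAxiomatisable demIdLang (fun (A : Type u) _ => RepClass demIdLang A) := by
  constructor
  · intro h
    obtain ⟨n, h1, h2⟩ := ((h.eventually_of_ultraproduct repClass_demLang_ultra).and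
      (eventually_lt 0)).exists
    exact not_repClass_demLang h2.ne' h1
  · intro h
    obtain ⟨n, h1, h2⟩ := ((h.eventually_of_ultraproduct repClass_demIdLang_ultra).and
      (eventually_lt 0)).exists
    exact not_repClass_demIdLang h2.ne' h1
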